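/- Let $\mathcal C$ be a (Barr-)exact Mal'tsev category with coequalizers: $\mathcal C$ is regular, every internal equivalence relation in $\mathcal C$ is a kernel pair, and every reflexive relation in $\mathcal C$ is an equivalence relation. Let $2\text{-}\mathbf{Eq}(\mathcal C)$ be the category whose objects are the triples $(X,R,S)$ with $R,S$ equivalence relations on an object $X$ of $\mathcal C$, and whose arrows $(X,R,S)\to(X',R',S')$ are the arrows $f\colon X\to X'$ of $\mathcal C$ that lift to arrows $R\to R'$ and $S\to S'$ commuting with the projections. A double equivalence relation on $R$ and $S$ is an object $D$ with projections $p_1,p_2\colon D\to R$ making it an equivalence relation on $R$ and $q_1,q_2\colon D\to S$ making it an equivalence relation on $S$, with $r_ip_j=s_jq_i$ for $i,j\in\{1,2\}$, where $r_i\colon R\to X$ and $s_j\colon S\to X$ are the projections. One says that $R$ and $S$ centralize each other if there is such a $D$ for which the square $r_2p_1=s_1q_2$ (equivalently, any of the four squares) is a pullback. Let $\mathbf{Conn}(\mathcal C)$ be the full subcategory of $2\text{-}\mathbf{Eq}(\mathcal C)$ of the triples $(X,R,S)$ such that $R$ and $S$ centralize each other. For a regular epimorphism $q\colon X\to Y$,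 let $q(R)$ be the regular image of $R$ in $Y\times Y$; it is an equivalence relation on $Y$. The commutator $[R,S]$ is the smallest equivalence relation on $X$ whose coequalizer $q$ is such that $q(R)$ and $q(S)$ centralize each other; write $q_{[R,S]}\colon X\to X/[R,S]$ for this coequalizer. A commutative square $hf=kg$, with $f\colon W\to X$, $g\colon W\to Y$, $h\colon X\to Z$, $k\colon Y\to Z$, is a regular pushout if the pullback $X\times_ZY$ of $h$ and $k$ exists and $f,g,h,k$, the two projections of $X\times_Z Y$ and the comparison arrow $\langle f,g\rangle\colon W\to X\times_ZY$ are all regular epimorphisms. A full reflective subcategory is strongly $\mathcal E$-Birkhoff, $\mathcal E$ being the class of regular epimorphisms of the ambient category, if for every $f\in\mathcal E$ the naturality square at $f$ of the unit of the reflection is a regular pushout. **Proposition.** 1. The commutator $[R,S]$ exists for every object $(X,R,S)$ of $2\text{-}\mathbf{Eq}(\mathcal C)$. 2. If $f\colon(X,R,S)\to(X',R',S')$ is a regular epimorphism in $2\text{-}\mathbf{Eq}(\mathcal C)$, then there is an arrow $\bar f$ of $2\text{-}\mathbf{Eq}(\mathcal C)$ for which the square $$\begin{array}{ccc}(X,R,S)&\xrightarrow{\;q_{[R,S]}\;}&\bigl(X/[R,S],\,q_{[R,S]}(R),\,q_{[R,S]}(S)\bigr)\\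 {\scriptstyle f}\downarrow&&\downarrow{\scriptstyle\bar f}\\ (X',R',S')&\xrightarrow{\;q_{[R',S']}\;}&\bigl(X'/[R',S'],\,q_{[R',S']}(R'),\,q_{[R',S']}(S')\bigr)\end{array}$$ commutes and is a regular pushout in $2\text{-}\mathbf{Eq}(\mathcal C)$. 3. $\mathbf{Conn}(\mathcal C)$ is a reflective subcategory of $2\text{-}\mathbf{Eq}(\mathcal C)$, and it is strongly $\mathcal E$-Birkhoff for the class $\mathcal E$ of regular epimorphisms in $2\text{-}\mathbf{Eq}(\mathcal C)$. -/

import Mathlib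

open CategoryTheory CategoryTheory.Limits

universe v u

namespace CommutatorTheory

section Basic

variable (C : Type u) [Category.{v} C]

/-- A Barr-exact category: a regular category in which every internal equivalence relation is
effective, that is, is the kernel pair of some arrow. -/
class BarrExact : Prop extends Regular C where
  effective : ∀ {E X : C} (p₁ p₂ : E ⟶ X), IsEquivalenceRelation p₁ p₂ →
    ∃ (Y : C) (f : X ⟶ Y), IsKernelPair f p₁ p₂

/-- A Mal'tsev category: a finitely complete category in which every reflexive relation is an
equivalence relation. -/
class Maltsev : Prop extends HasFiniteLimits C where
  isEquivalenceRelation : ∀ {E X : C} (p₁ p₂ : E ⟶ X),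
    Nonempty (ReflexiveRelation p₁ p₂) → IsEquivalenceRelation p₁ p₂

variable {C}

/-- An internal equivalence relation on the object `X`. -/
structure EqRel (X : C) where
  /-- the object of related pairs -/
  obj : C
  fst : obj ⟶ X
  snd : obj ⟶ X
  isEquivalenceRelation : IsEquivalenceRelation fst snd

/-- The order of equivalence relations on `X` as subobjects of `X ⨯ X`. -/
instance EqRel.instLE (X : C) : LE (EqRel X) where
  le R S := ∃ g : R.obj ⟶ S.obj, g ≫ S.fst = R.fst ∧ g ≫ S.snd = R.snd

/-- The arrow `f : X ⟶ Y` carries related pairs of `R` to related pairs of `T`: it lifts to an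
arrow between the relations (equivalently, the direct image of `R` is contained in `T`). -/
def EqRel.Respects {X Y : C} (f : X ⟶ Y) (R : EqRel X) (T : EqRel Y) : Prop :=
  ∃ g : R.obj ⟶ T.obj, g ≫ T.fst = R.fst ≫ f ∧ g ≫ T.snd = R.snd ≫ f

/-- A centralizing double equivalence relation on `R` and `S`. In generalized elements, `obj`
consists of squares `(a b; d c)` with `a R b`, `d R c`, `a S d`, `b S c`; the projections are
`p₁ = (a, b)`, `p₂ = (d, c)` to `R` and `q₁ = (a, d)`, `q₂ = (b, c)` to `S`. It is centralizing when
`(a, b, c)` determines the square uniquely and may be arbitrary with `a R b` and `b S c`.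
(By symmetry of the relations, the other three commutative squares are then pullbacks too, and any
one of them being a pullback implies that this one is.) -/
structure CentralizingRelation {X : C} (R S : EqRel X) where
  obj : C
  p₁ : obj ⟶ R.obj
  p₂ : obj ⟶ R.obj
  q₁ : obj ⟶ S.obj
  q₂ : obj ⟶ S.obj
  isEquivalenceRelation_p : IsEquivalenceRelation p₁ p₂
  isEquivalenceRelation_q : IsEquivalenceRelation q₁ q₂
  comm₁₁ : p₁ ≫ R.fst = q₁ ≫ S.fst
  comm₁₂ : p₂ ≫ R.fst = q₁ ≫ S.snd
  comm₂₁ : p₁ ≫ R.snd = q₂ ≫ S.fst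
  comm₂₂ : p₂ ≫ R.snd = q₂ ≫ S.snd
  isPullback : IsPullback p₁ q₂ R.snd S.fst

/-- Two equivalence relations on the same object centralize each other (are connected). -/
def Centralize {X : C} (R S : EqRel X) : Prop :=
  Nonempty (CentralizingRelation R S)

variable (C) in
/-- Objects of the category `2-Eq(C)`: an object with two equivalence relations on it. -/
structure TwoEq where
  carrier : C
  R : EqRel carrier
  S : EqRel carrier

/-- Arrows of `2-Eq(C)`. -/
@[ext]
structure TwoEq.Hom (A B : TwoEq C) where
  hom : A.carrier ⟶ B.carrier
  respects_R : EqRel.Respects hom A.R B.R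
  respects_S : EqRel.Respects hom A.S B.S

theorem EqRel.respects_id {X : C} (R : EqRel X) : EqRel.Respects (𝟙 X) R R :=
  ⟨𝟙 _, by simp, by simp⟩

theorem EqRel.Respects.comp {X Y Z : C} {f : X ⟶ Y} {g : Y ⟶ Z} {R : EqRel X} {S : EqRel Y}
    {T : EqRel Z} (h : EqRel.Respects f R S) (k : EqRel.Respects g S T) :
    EqRel.Respects (f ≫ g) R T := by
  obtain ⟨a, ha₁, ha₂⟩ := h
  obtain ⟨b, hb₁, hb₂⟩ := k
  refine ⟨a ≫ b, ?_, ?_⟩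
  · rw [Category.assoc, hb₁, ← Category.assoc, ha₁, Category.assoc]
  · rw [Category.assoc, hb₂, ← Category.assoc, ha₂, Category.assoc]

/-- The category `2-Eq(C)`, with composition and identities those of `C`. -/
instance TwoEq.instCategory : Category (TwoEq C) where
  Hom := TwoEq.Hom
  id A := ⟨𝟙 A.carrier, A.R.respects_id, A.S.respects_id⟩
  comp f g := ⟨f.hom ≫ g.hom, f.respects_R.comp g.respects_R, f.respects_S.comp g.respects_S⟩
  id_comp _ := TwoEq.Hom.ext (Category.id_comp _)
  comp_id _ := TwoEq.Hom.ext (Category.comp_id _)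
  assoc _ _ _ := TwoEq.Hom.ext (Category.assoc _ _ _)

variable (C) in
/-- The full subcategory `Conn(C)` of `2-Eq(C)`: the triples `(X, R, S)` such that `R` and `S`
centralize each other. -/
def Conn : ObjectProperty (TwoEq C) := fun A => Centralize A.R A.S

end Basic

section RegularPushout

variable {D : Type u} [Category.{v} D]

/-- A commutative square
```
  W --g--> Y
  |        |
  f        k
  v        v
  X --h--> Z
```
is a regular pushout if its four sides, the two projections of the pullback of `h` and `k`, and the
comparison arrow from `W` to that pullback are all regular epimorphisms. -/
structure IsRegularPushout {W X Y Z : D} (f : W ⟶ X) (g : W ⟶ Y) (h : X ⟶ Z) (k : Y ⟶ Z) :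
    Prop where
  w : f ≫ h = g ≫ k
  isRegularEpi_f : IsRegularEpi f
  isRegularEpi_g : IsRegularEpi g
  isRegularEpi_h : IsRegularEpi h
  isRegularEpi_k : IsRegularEpi k
  comparison : ∃ (P : D) (fst : P ⟶ X) (snd : P ⟶ Y) (hP : IsPullback fst snd h k),
    IsRegularEpi fst ∧ IsRegularEpi snd ∧ IsRegularEpi (hP.lift f g w)

/-- A full subcategory is strongly Birkhoff (with respect to the class of regular epimorphisms) if
it is reflective and, for every regular epimorphism `f`, the naturality square at `f` of the unit of
the reflection is a regular pushout. -/
structure IsStronglyBirkhoff (P : ObjectProperty D) : Prop where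
  reflective : Nonempty (Reflective P.ι)
  isRegularPushout : ∀ (_ : Reflective P.ι) {A B : D} (f : A ⟶ B), IsRegularEpi f →
    IsRegularPushout f ((reflectorAdjunction P.ι).unit.app A)
      ((reflectorAdjunction P.ι).unit.app B) (P.ι.map ((reflector P.ι).map f))

end RegularPushout

noncomputable section Commutator

variable {C : Type u} [Category.{v} C]

/-- The regular image factorization of the arrow `E ⟶ Y ⨯ Y` given by a parallel pair. -/
def pairImage [Regular C] {E Y : C} (a b : E ⟶ Y) : StrongEpiMonoFactorisation (prod.lift a b) :=
  Regular.strongEpiMonoFactorisation (prod.lift a b)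

theorem image_isEquivalenceRelation [Regular C] [Maltsev C] {X Y : C} (f : X ⟶ Y)
    [IsRegularEpi f] (R : EqRel X) :
    IsEquivalenceRelation ((pairImage (R.fst ≫ f) (R.snd ≫ f)).m ≫ prod.fst)
      ((pairImage (R.fst ≫ f) (R.snd ≫ f)).m ≫ prod.snd) := by
  apply Maltsev.isEquivalenceRelation
  obtain ⟨⟨e⟩⟩ := R.isEquivalenceRelation
  have sq : CommSq (e.r ≫ (pairImage (R.fst ≫ f) (R.snd ≫ f)).e) f
      (pairImage (R.fst ≫ f) (R.snd ≫ f)).m (prod.lift (𝟙 Y) (𝟙 Y)) := by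
    constructor
    rw [Category.assoc, (pairImage (R.fst ≫ f) (R.snd ≫ f)).fac]
    ext <;> simp
  have h := sq.fac_right
  exact ⟨{
    right_cancellation := fun Z a b h₁ h₂ => by
      rw [← cancel_mono (pairImage (R.fst ≫ f) (R.snd ≫ f)).m]
      ext
      · simpa using h₁
      · simpa using h₂
    r := sq.lift
    reflexivity₁ := by rw [← Category.assoc, h, prod.lift_fst]
    reflexivity₂ := by rw [← Category.assoc, h, prod.lift_snd] }⟩

/-- The direct image `f(R)` of an equivalence relation along a regular epimorphism: the regular
image of `R ⟶ X ⨯ X ⟶ Y ⨯ Y`. -/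
def EqRel.directImage [Regular C] [Maltsev C] {X Y : C} (f : X ⟶ Y) [IsRegularEpi f]
    (R : EqRel X) : EqRel Y where
  obj := (pairImage (R.fst ≫ f) (R.snd ≫ f)).I
  fst := (pairImage (R.fst ≫ f) (R.snd ≫ f)).m ≫ prod.fst
  snd := (pairImage (R.fst ≫ f) (R.snd ≫ f)).m ≫ prod.snd
  isEquivalenceRelation := image_isEquivalenceRelation f R

theorem EqRel.respects_directImage [Regular C] [Maltsev C] {X Y : C} (f : X ⟶ Y)
    [IsRegularEpi f] (R : EqRel X) : EqRel.Respects f R (R.directImage f) := by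
  have h := (pairImage (R.fst ≫ f) (R.snd ≫ f)).fac
  have h₁ : (pairImage (R.fst ≫ f) (R.snd ≫ f)).e ≫
      (pairImage (R.fst ≫ f) (R.snd ≫ f)).m ≫ prod.fst = R.fst ≫ f := by
    rw [← Category.assoc, h, prod.lift_fst]
  have h₂ : (pairImage (R.fst ≫ f) (R.snd ≫ f)).e ≫
      (pairImage (R.fst ≫ f) (R.snd ≫ f)).m ≫ prod.snd = R.snd ≫ f := by
    rw [← Category.assoc, h, prod.lift_snd]
  exact ⟨(pairImage (R.fst ≫ f) (R.snd ≫ f)).e, h₁, h₂⟩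

variable [HasCoequalizers C]

/-- The canonical quotient `X ⟶ X/T` of `X` by an equivalence relation `T`: the coequalizer of its
two projections. -/
abbrev EqRel.quotientMap {X : C} (T : EqRel X) : X ⟶ coequalizer T.fst T.snd :=
  coequalizer.π T.fst T.snd

/-- `T` is the commutator `[R, S]`: the smallest equivalence relation on `X` whose coequalizer `q`
is such that `q(R)` and `q(S)` centralize each other. -/
structure IsCommutator [Regular C] [Maltsev C] {X : C} (R S T : EqRel X) : Prop where
  centralize : Centralize (R.directImage T.quotientMap) (S.directImage T.quotientMap)
  le : ∀ T' : EqRel X,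
    Centralize (R.directImage T'.quotientMap) (S.directImage T'.quotientMap) → T ≤ T'

/-- The quotient `(X/T, q(R), q(S))` of `(X, R, S)` by an equivalence relation `T` on `X`, where
`q : X ⟶ X/T` is the canonical quotient. -/
def TwoEq.quotient [Regular C] [Maltsev C] (A : TwoEq C) (T : EqRel A.carrier) : TwoEq C where
  carrier := coequalizer T.fst T.snd
  R := A.R.directImage T.quotientMap
  S := A.S.directImage T.quotientMap

/-- The canonical quotient `q : X ⟶ X/T` as an arrow `(X, R, S) ⟶ (X/T, q(R), q(S))`. -/
def TwoEq.toQuotient [Regular C] [Maltsev C] (A : TwoEq C) (T : EqRel A.carrier) :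
    A ⟶ A.quotient T where
  hom := T.quotientMap
  respects_R := A.R.respects_directImage T.quotientMap
  respects_S := A.S.respects_directImage T.quotientMap

end Commutator

end CommutatorTheory

open CommutatorTheory

/-! Relations are handled through generalized elements, and lifts along regular epimorphisms are
taken after passing to a cover. A matrix (a b; d c) has its rows in `R` and its columns in `S`. Let
`R.squares S` be the equivalence relation on `R` generated by the squares (b b; c c) with b S c. The
Mal'tsev property makes it a double equivalence relation, so squares paste along a side in `S`. Then
a [R,S] d means that locally some (a b; d b) is such a square. In a centralizing relation a square
with one trivial side in `S` has both trivial, so every arrow to a centralizing pair identifies a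
and d (`TwoEq.eq_of_commutator`). Conversely, pasting shows that the quotient by this relation
satisfies the criterion `IsSquareRel.centralize` (`TwoEq.centralize_quotient_commutator`). For the
regular pushout, images of centralizing pairs centralize (`TwoEq.IsSurj.centralize_of_centralize`).
Hence the kernel pair of one quotient by a commutator maps onto that of the other, and permuting
kernel pairs makes the comparison arrow a regular epimorphism in `C`. Since [R,S] lies in both `R`
and `S`, the comparison is also surjective on relations, which characterizes the regular
epimorphisms of 2-Eq(C). -/

namespace CommutatorTheory

variable {C : Type u} [Category.{v} C]

attribute [local simp] prod.lift_fst prod.lift_snd prod.lift_fst_assoc prod.lift_snd_assoc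
  pullback.lift_fst pullback.lift_snd pullback.lift_fst_assoc pullback.lift_snd_assoc

/-! ### Covers and local lifts in a regular category -/

section RegularCategory

variable [Regular C]

theorem isRegularEpi_of_strongEpi {X Y : C} (f : X ⟶ Y) [StrongEpi f] : IsRegularEpi f :=
  inferInstance

theorem isRegularEpi_comp {X Y Z : C} (f : X ⟶ Y) (g : Y ⟶ Z) (hf : IsRegularEpi f)
    (hg : IsRegularEpi g) : IsRegularEpi (f ≫ g) :=
  have := strongEpi_comp f g
  isRegularEpi_of_strongEpi _

theorem isRegularEpi_of_comp {X Y Z : C} (f : X ⟶ Y) (g : Y ⟶ Z) (h : IsRegularEpi (f ≫ g)) :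
    IsRegularEpi g :=
  have := strongEpi_of_strongEpi f g
  isRegularEpi_of_strongEpi _

/-- Generalized elements lift along a regular epimorphism after passing to a cover. -/
theorem exists_local_lift {X Y Z : C} (f : X ⟶ Y) [IsRegularEpi f] (z : Z ⟶ Y) :
    ∃ (Z' : C) (p : Z' ⟶ Z) (w : Z' ⟶ X), IsRegularEpi p ∧ w ≫ f = p ≫ z :=
  ⟨_, pullback.snd f z, pullback.fst f z, inferInstance, pullback.condition⟩

theorem isRegularEpi_of_local_lift {X Y : C} (f : X ⟶ Y)
    (h : ∃ (Z' : C) (p : Z' ⟶ Y) (w : Z' ⟶ X), IsRegularEpi p ∧ w ≫ f = p) : IsRegularEpi f := by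
  obtain ⟨Z', p, w, hp, rfl⟩ := h
  exact isRegularEpi_of_comp w f hp

theorem exists_lift_of_pairImage {E Y : C} (a b : E ⟶ Y) {Z : C} (g : Z ⟶ (pairImage a b).I) :
    ∃ (Z' : C) (p : Z' ⟶ Z) (k : Z' ⟶ E), IsRegularEpi p ∧
      k ≫ a = p ≫ g ≫ (pairImage a b).m ≫ prod.fst ∧
      k ≫ b = p ≫ g ≫ (pairImage a b).m ≫ prod.snd := by
  have := isRegularEpi_of_strongEpi (pairImage a b).e
  obtain ⟨Z', p, k, hp, hk⟩ := exists_local_lift (pairImage a b).e g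
  have hf := (pairImage a b).fac
  refine ⟨Z', p, k, hp, ?_, ?_⟩
  · rw [← reassoc_of% hk, reassoc_of% hf, prod.lift_fst]
  · rw [← reassoc_of% hk, reassoc_of% hf, prod.lift_snd]

end RegularCategory

/-! ### Equivalence relations on generalized elements -/

namespace EqRel

variable {X : C}

/-- The generalized elements `a` and `b` of `X` are related by `R`. -/
def Rel (R : EqRel X) {Z : C} (a b : Z ⟶ X) : Prop :=
  ∃ g : Z ⟶ R.obj, g ≫ R.fst = a ∧ g ≫ R.snd = b

theorem hom_ext (R : EqRel X) {Z : C} {g h : Z ⟶ R.obj} (h₁ : g ≫ R.fst = h ≫ R.fst)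
    (h₂ : g ≫ R.snd = h ≫ R.snd) : g = h := by
  obtain ⟨⟨e⟩⟩ := R.isEquivalenceRelation
  exact e.right_cancellation _ _ h₁ h₂

theorem rel_self (R : EqRel X) {Z : C} (g : Z ⟶ R.obj) : R.Rel (g ≫ R.fst) (g ≫ R.snd) :=
  ⟨g, rfl, rfl⟩

theorem Rel.precomp {R : EqRel X} {Z Z' : C} {a b : Z ⟶ X} (h : R.Rel a b) (p : Z' ⟶ Z) :
    R.Rel (p ≫ a) (p ≫ b) := by
  obtain ⟨g, rfl, rfl⟩ := h
  exact ⟨p ≫ g, Category.assoc _ _ _, Category.assoc _ _ _⟩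

theorem exists_diag (R : EqRel X) : ∃ d : X ⟶ R.obj, d ≫ R.fst = 𝟙 X ∧ d ≫ R.snd = 𝟙 X := by
  obtain ⟨⟨e⟩⟩ := R.isEquivalenceRelation
  exact ⟨e.r, e.reflexivity₁, e.reflexivity₂⟩

/-- The diagonal of a reflexive relation. -/
noncomputable def diag (R : EqRel X) : X ⟶ R.obj := R.exists_diag.choose

@[simp]
theorem diag_fst (R : EqRel X) : R.diag ≫ R.fst = 𝟙 X := R.exists_diag.choose_spec.1

@[simp]
theorem diag_snd (R : EqRel X) : R.diag ≫ R.snd = 𝟙 X := R.exists_diag.choose_spec.2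

@[simp]
theorem diag_fst_assoc (R : EqRel X) {Y : C} (f : X ⟶ Y) : R.diag ≫ R.fst ≫ f = f := by
  rw [← Category.assoc, diag_fst, Category.id_comp]

@[simp]
theorem diag_snd_assoc (R : EqRel X) {Y : C} (f : X ⟶ Y) : R.diag ≫ R.snd ≫ f = f := by
  rw [← Category.assoc, diag_snd, Category.id_comp]

theorem Rel.refl (R : EqRel X) {Z : C} (a : Z ⟶ X) : R.Rel a a :=
  ⟨a ≫ R.diag, by simp, by simp⟩

theorem Rel.symm {R : EqRel X} {Z : C} {a b : Z ⟶ X} (h : R.Rel a b) : R.Rel b a := by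
  obtain ⟨⟨e⟩⟩ := R.isEquivalenceRelation
  obtain ⟨g, rfl, rfl⟩ := h
  exact ⟨g ≫ e.s, by rw [Category.assoc, e.symmetry₁], by rw [Category.assoc, e.symmetry₂]⟩

theorem Rel.trans {R : EqRel X} {Z : C} {a b c : Z ⟶ X} (h : R.Rel a b) (k : R.Rel b c) :
    R.Rel a c := by
  obtain ⟨⟨e⟩⟩ := R.isEquivalenceRelation
  obtain ⟨g, rfl, rfl⟩ := h
  obtain ⟨g', hg, rfl⟩ := k
  have h₁ := PullbackCone.IsLimit.lift_fst e.isLimit g g' hg.symm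
  have h₂ := PullbackCone.IsLimit.lift_snd e.isLimit g g' hg.symm
  refine ⟨PullbackCone.IsLimit.lift e.isLimit g g' hg.symm ≫ e.t, ?_, ?_⟩
  · rw [Category.assoc, e.transitivity₁, reassoc_of% h₁]
  · rw [Category.assoc, e.transitivity₂, reassoc_of% h₂]

theorem le_iff {R S : EqRel X} :
    R ≤ S ↔ ∀ ⦃Z : C⦄ (a b : Z ⟶ X), R.Rel a b → S.Rel a b := by
  constructor
  · rintro ⟨g, h₁, h₂⟩ Z a b ⟨k, rfl, rfl⟩
    exact ⟨k ≫ g, by rw [Category.assoc, h₁], by rw [Category.assoc, h₂]⟩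
  · intro h
    exact h R.fst R.snd ⟨𝟙 _, by simp, by simp⟩

theorem respects_iff {Y : C} {f : X ⟶ Y} {R : EqRel X} {T : EqRel Y} :
    Respects f R T ↔ ∀ ⦃Z : C⦄ (a b : Z ⟶ X), R.Rel a b → T.Rel (a ≫ f) (b ≫ f) := by
  constructor
  · rintro ⟨g, h₁, h₂⟩ Z a b ⟨k, rfl, rfl⟩
    exact ⟨k ≫ g, by simp [h₁], by simp [h₂]⟩
  · intro h
    exact h R.fst R.snd ⟨𝟙 _, by simp, by simp⟩

theorem mono_lift [HasBinaryProducts C] (R : EqRel X) : Mono (prod.lift R.fst R.snd) where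
  right_cancellation g h w := by
    apply R.hom_ext
    · simpa using congrArg (· ≫ prod.fst) w
    · simpa using congrArg (· ≫ prod.snd) w

/-- A relation is a monomorphism into the product, so strong epimorphisms lift against it. This
makes it harmless to check relations on a cover. -/
theorem Rel.of_cover [HasBinaryProducts C] {R : EqRel X} {Z Z' : C} {a b : Z ⟶ X} (p : Z' ⟶ Z)
    [StrongEpi p] (h : R.Rel (p ≫ a) (p ≫ b)) : R.Rel a b := by
  obtain ⟨g, h₁, h₂⟩ := h
  have := R.mono_lift
  have sq : CommSq g p (prod.lift R.fst R.snd) (prod.lift a b) := by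
    constructor
    ext <;> simp [h₁, h₂]
  have h := sq.fac_right
  refine ⟨sq.lift, ?_, ?_⟩
  · simpa using congrArg (· ≫ prod.fst) h
  · simpa using congrArg (· ≫ prod.snd) h

/-- Every pair of elements related by `T` lifts, after passing to a cover, along `f` to a pair
related by `R`. -/
def LiftsLocally {X Y : C} (f : X ⟶ Y) (R : EqRel X) (T : EqRel Y) : Prop :=
  ∀ ⦃Z : C⦄ (a b : Z ⟶ Y), T.Rel a b → ∃ (Z' : C) (p : Z' ⟶ Z) (x y : Z' ⟶ X),
    IsRegularEpi p ∧ R.Rel x y ∧ x ≫ f = p ≫ a ∧ y ≫ f = p ≫ b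

theorem LiftsLocally.respects [HasBinaryProducts C] {X Y W : C} {f : X ⟶ Y} {g : Y ⟶ W}
    {R : EqRel X} {S : EqRel Y} {T : EqRel W} (h : LiftsLocally f R S)
    (hg : Respects (f ≫ g) R T) : Respects g S T := by
  rw [respects_iff] at hg ⊢
  intro Z a b hab
  obtain ⟨Z', p, x, y, hp, hxy, hx, hy⟩ := h a b hab
  apply Rel.of_cover p
  rw [← reassoc_of% hx, ← reassoc_of% hy]
  exact hg x y hxy

end EqRel

/-! ### Difunctionality and constructions of equivalence relations -/

section Maltsev

variable [Maltsev C]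

/-- In a Mal'tsev category, a monomorphism into `X ⨯ X` through which the diagonal factors is an
equivalence relation. -/
noncomputable def EqRel.ofMono {V X : C} (m : V ⟶ X ⨯ X) [Mono m]
    (h : ∃ r : X ⟶ V, r ≫ m = prod.lift (𝟙 X) (𝟙 X)) : EqRel X where
  obj := V
  fst := m ≫ prod.fst
  snd := m ≫ prod.snd
  isEquivalenceRelation := Maltsev.isEquivalenceRelation _ _ <| by
    obtain ⟨r, hr⟩ := h
    exact ⟨{
      right_cancellation := fun Z a b h₁ h₂ => by
        rw [← cancel_mono m]
        ext
        · simpa using h₁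
        · simpa using h₂
      r := r
      reflexivity₁ := by rw [← Category.assoc, hr, prod.lift_fst]
      reflexivity₂ := by rw [← Category.assoc, hr, prod.lift_snd] }⟩

theorem EqRel.rel_ofMono {V X : C} (m : V ⟶ X ⨯ X) [Mono m]
    (h : ∃ r : X ⟶ V, r ≫ m = prod.lift (𝟙 X) (𝟙 X)) {Z : C} (a b : Z ⟶ X) :
    (EqRel.ofMono m h).Rel a b ↔ ∃ g : Z ⟶ V, g ≫ m = prod.lift a b := by
  constructor
  · rintro ⟨g, rfl, rfl⟩
    refine ⟨g, prod.hom_ext ?_ ?_⟩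
    · exact (Category.assoc _ _ _).trans (prod.lift_fst _ _).symm
    · exact (Category.assoc _ _ _).trans (prod.lift_snd _ _).symm
  · rintro ⟨g, hg⟩
    exact ⟨g, by simp [EqRel.ofMono, reassoc_of% hg], by simp [EqRel.ofMono, reassoc_of% hg]⟩

/-- Relations in a Mal'tsev category are difunctional. -/
theorem difunctional {W A B : C} (p : W ⟶ A) (q : W ⟶ B) [Mono (prod.lift p q)] {Z : C}
    {w₁ w₂ w₃ : Z ⟶ W} (h₁ : w₁ ≫ q = w₂ ≫ q) (h₂ : w₂ ≫ p = w₃ ≫ p) :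
    ∃ w : Z ⟶ W, w ≫ p = w₁ ≫ p ∧ w ≫ q = w₃ ≫ q := by
  -- Relate w to w' when some element of `W` lies over (p w, q w'). This relation is reflexive,
  -- hence symmetric; `w₂` witnesses that `w₃` is related to `w₁`, and symmetry gives the claim.
  have hr : ∃ r : W ⟶ pullback (prod.map p q) (prod.lift p q),
      r ≫ pullback.fst (prod.map p q) (prod.lift p q) = prod.lift (𝟙 W) (𝟙 W) :=
    ⟨pullback.lift (prod.lift (𝟙 W) (𝟙 W)) (𝟙 W) (by simp), by simp⟩
  have key : ∀ w w' : Z ⟶ W, (EqRel.ofMono _ hr).Rel w w' ↔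
      ∃ t : Z ⟶ W, t ≫ p = w ≫ p ∧ t ≫ q = w' ≫ q := by
    intro w w'
    rw [EqRel.rel_ofMono]
    constructor
    · rintro ⟨g, hg⟩
      have hc := congrArg (g ≫ ·) (pullback.condition (f := prod.map p q) (g := prod.lift p q))
      simp only [reassoc_of% hg] at hc
      refine ⟨g ≫ pullback.snd _ _, ?_, ?_⟩
      · simpa using (congrArg (· ≫ prod.fst) hc).symm
      · simpa using (congrArg (· ≫ prod.snd) hc).symm
    · rintro ⟨t, ht₁, ht₂⟩
      exact ⟨pullback.lift (prod.lift w w') t (by ext <;> simp [ht₁, ht₂]), by simp⟩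
  exact (key w₁ w₃).1 ((key w₃ w₁).2 ⟨w₂, h₂, h₁.symm⟩).symm

namespace EqRel

variable {X Y : C}

/-- The inverse image of an equivalence relation. -/
noncomputable def comap (f : X ⟶ Y) (R : EqRel Y) : EqRel X :=
  have := R.mono_lift
  ofMono (pullback.snd (prod.lift R.fst R.snd) (prod.map f f))
    ⟨pullback.lift (f ≫ R.diag) (prod.lift (𝟙 X) (𝟙 X)) (by simp), by simp⟩

theorem rel_comap (f : X ⟶ Y) (R : EqRel Y) {Z : C} (a b : Z ⟶ X) :
    (R.comap f).Rel a b ↔ R.Rel (a ≫ f) (b ≫ f) := by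
  have := R.mono_lift
  rw [comap, rel_ofMono]
  constructor
  · rintro ⟨g, hg⟩
    have hc := congrArg (g ≫ ·)
      (pullback.condition (f := prod.lift R.fst R.snd) (g := prod.map f f))
    simp only [reassoc_of% hg] at hc
    refine ⟨g ≫ pullback.fst _ _, ?_, ?_⟩
    · simpa using congrArg (· ≫ prod.fst) hc
    · simpa using congrArg (· ≫ prod.snd) hc
  · rintro ⟨g, h₁, h₂⟩
    exact ⟨pullback.lift g (prod.lift a b) (by ext <;> simp [h₁, h₂]), by simp⟩

/-- The intersection of two equivalence relations. -/
noncomputable def inf (R S : EqRel X) : EqRel X :=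
  have := R.mono_lift
  have := S.mono_lift
  ofMono (pullback.fst (prod.lift R.fst R.snd) (prod.lift S.fst S.snd) ≫ prod.lift R.fst R.snd)
    ⟨pullback.lift R.diag S.diag (by simp), by simp⟩

theorem rel_inf (R S : EqRel X) {Z : C} (a b : Z ⟶ X) :
    (R.inf S).Rel a b ↔ R.Rel a b ∧ S.Rel a b := by
  have := R.mono_lift
  have := S.mono_lift
  rw [inf, rel_ofMono]
  constructor
  · rintro ⟨g, hg⟩
    have hg' := hg
    rw [pullback.condition] at hg'
    refine ⟨⟨g ≫ pullback.fst _ _, ?_, ?_⟩, ⟨g ≫ pullback.snd _ _, ?_, ?_⟩⟩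
    · simpa using congrArg (· ≫ prod.fst) hg
    · simpa using congrArg (· ≫ prod.snd) hg
    · simpa using congrArg (· ≫ prod.fst) hg'
    · simpa using congrArg (· ≫ prod.snd) hg'
  · rintro ⟨⟨g, rfl, rfl⟩, ⟨g', h₁, h₂⟩⟩
    exact ⟨pullback.lift g g' (by ext <;> simp [h₁, h₂]), by simp⟩

/-- The kernel pair of an arrow. -/
noncomputable def ker (f : X ⟶ Y) : EqRel X where
  obj := pullback f f
  fst := pullback.fst f f
  snd := pullback.snd f f
  isEquivalenceRelation := Maltsev.isEquivalenceRelation _ _ ⟨{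
    right_cancellation := fun _ _ _ h₁ h₂ => pullback.hom_ext h₁ h₂
    r := pullback.lift (𝟙 X) (𝟙 X) rfl
    reflexivity₁ := by simp
    reflexivity₂ := by simp }⟩

theorem rel_ker (f : X ⟶ Y) {Z : C} (a b : Z ⟶ X) : (ker f).Rel a b ↔ a ≫ f = b ≫ f := by
  constructor
  · rintro ⟨g, rfl, rfl⟩
    exact (Category.assoc _ _ _).trans
      ((congrArg (g ≫ ·) pullback.condition).trans (Category.assoc _ _ _).symm)
  · intro h
    exact ⟨pullback.lift a b h, by simp [ker], by simp [ker]⟩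

variable (X) in
/-- The discrete equivalence relation. -/
noncomputable def discrete : EqRel X := ker (𝟙 X)

theorem respects_discrete (f : X ⟶ Y) (R : EqRel Y) : Respects f (discrete X) R := by
  rw [respects_iff]
  intro Z a b h
  rw [discrete, rel_ker, Category.comp_id, Category.comp_id] at h
  rw [h]
  exact Rel.refl _ _

section Regular

variable [Regular C]

/-- The image in `X ⨯ X` of a pair of arrows with a common section. -/
noncomputable def ofPair {K : C} (a b : K ⟶ X) (h : ∃ r : X ⟶ K, r ≫ a = 𝟙 X ∧ r ≫ b = 𝟙 X) :
    EqRel X :=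
  ofMono (pairImage a b).m <| by
    obtain ⟨r, h₁, h₂⟩ := h
    refine ⟨r ≫ (pairImage a b).e, ?_⟩
    rw [Category.assoc, (pairImage a b).fac]
    ext <;> simp [h₁, h₂]

theorem rel_ofPair {K : C} (a b : K ⟶ X) (h : ∃ r : X ⟶ K, r ≫ a = 𝟙 X ∧ r ≫ b = 𝟙 X) {Z : C}
    (x y : Z ⟶ X) : (ofPair a b h).Rel x y ↔ ∃ (Z' : C) (p : Z' ⟶ Z) (k : Z' ⟶ K),
      IsRegularEpi p ∧ k ≫ a = p ≫ x ∧ k ≫ b = p ≫ y := by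
  constructor
  · rintro ⟨g, rfl, rfl⟩
    exact exists_lift_of_pairImage a b g
  · rintro ⟨Z', p, k, hp, h₁, h₂⟩
    apply Rel.of_cover p
    rw [← h₁, ← h₂]
    apply Rel.precomp
    have hf := (pairImage a b).fac
    refine ⟨(pairImage a b).e, ?_, ?_⟩
    · simp only [ofPair, ofMono, reassoc_of% hf, prod.lift_fst]
    · simp only [ofPair, ofMono, reassoc_of% hf, prod.lift_snd]

theorem liftsLocally_directImage (f : X ⟶ Y) [IsRegularEpi f] (R : EqRel X) :
    LiftsLocally f R (R.directImage f) := by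
  rintro Z a b ⟨g, rfl, rfl⟩
  obtain ⟨Z', p, k, hp, h₁, h₂⟩ := exists_lift_of_pairImage (R.fst ≫ f) (R.snd ≫ f) g
  exact ⟨Z', p, k ≫ R.fst, k ≫ R.snd, hp, R.rel_self k, (Category.assoc _ _ _).trans h₁,
    (Category.assoc _ _ _).trans h₂⟩

end Regular

end EqRel

end Maltsev

/-! ### Effectiveness of equivalence relations -/

section Exact

variable {X : C} [BarrExact C] [HasCoequalizers C]

/-- By exactness `R` is the kernel pair of some arrow. That arrow factors through the coequalizer,
so the coequalizer identifies no more than `R` does. -/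
theorem EqRel.rel_iff_quotientMap (R : EqRel X) {Z : C} (a b : Z ⟶ X) :
    R.Rel a b ↔ a ≫ R.quotientMap = b ≫ R.quotientMap := by
  constructor
  · rintro ⟨g, rfl, rfl⟩
    rw [Category.assoc, Category.assoc, coequalizer.condition]
  · intro h
    obtain ⟨Q, f, hf⟩ := BarrExact.effective R.fst R.snd R.isEquivalenceRelation
    have : a ≫ f = b ≫ f := by
      rw [← coequalizer.π_desc f hf.w, reassoc_of% h]
    exact ⟨hf.lift a b this, hf.lift_fst _ _ _, hf.lift_snd _ _ _⟩

end Exact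


/-! ### Double equivalence relations and centralization -/

section Squares

variable {X : C} {R S : EqRel X}

/-- A relation between pairs `(a, b)` and `(d, c)` of `R` which implies `a S d` and `b S c`, and
which relates `(b, b)` and `(c, c)` whenever `b S c`. -/
structure IsSquareRel (R S : EqRel X) (E : EqRel R.obj) : Prop where
  rel_fst : ∀ ⦃Z : C⦄ (u v : Z ⟶ R.obj), E.Rel u v → S.Rel (u ≫ R.fst) (v ≫ R.fst)
  rel_snd : ∀ ⦃Z : C⦄ (u v : Z ⟶ R.obj), E.Rel u v → S.Rel (u ≫ R.snd) (v ≫ R.snd)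
  rel_diag : ∀ ⦃Z : C⦄ (b c : Z ⟶ X), S.Rel b c → E.Rel (b ≫ R.diag) (c ≫ R.diag)

namespace IsSquareRel

variable [Maltsev C] {E : EqRel R.obj}

/-- The two sides in `S` determine all four corners, so they form a relation on `S`. The squares (b
b; c c) make it reflexive; the Mal'tsev property does the rest. -/
theorem exists_horizontal (h : IsSquareRel R S E) :
    ∃ q₁ q₂ : E.obj ⟶ S.obj, q₁ ≫ S.fst = E.fst ≫ R.fst ∧ q₁ ≫ S.snd = E.snd ≫ R.fst ∧
      q₂ ≫ S.fst = E.fst ≫ R.snd ∧ q₂ ≫ S.snd = E.snd ≫ R.snd ∧ IsEquivalenceRelation q₁ q₂ := by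
  have hE : E.Rel E.fst E.snd := ⟨𝟙 _, by simp, by simp⟩
  have hS : S.Rel S.fst S.snd := ⟨𝟙 _, by simp, by simp⟩
  obtain ⟨q₁, h₁₁, h₁₂⟩ := h.rel_fst _ _ hE
  obtain ⟨q₂, h₂₁, h₂₂⟩ := h.rel_snd _ _ hE
  obtain ⟨r, hr₁, hr₂⟩ := h.rel_diag _ _ hS
  refine ⟨q₁, q₂, h₁₁, h₁₂, h₂₁, h₂₂, Maltsev.isEquivalenceRelation _ _ ⟨{
    right_cancellation := fun Z f g e₁ e₂ => ?_
    r := r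
    reflexivity₁ := ?_
    reflexivity₂ := ?_ }⟩⟩
  · apply E.hom_ext <;> apply R.hom_ext <;> simp only [Category.assoc]
    · rw [← h₁₁, reassoc_of% e₁]
    · rw [← h₂₁, reassoc_of% e₂]
    · rw [← h₁₂, reassoc_of% e₁]
    · rw [← h₂₂, reassoc_of% e₂]
  · apply S.hom_ext
    · simp [h₁₁, reassoc_of% hr₁]
    · simp [h₁₂, reassoc_of% hr₂]
  · apply S.hom_ext
    · simp [h₂₁, reassoc_of% hr₁]
    · simp [h₂₂, reassoc_of% hr₂]

/-- Squares can be pasted along a common side in `S`. -/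
theorem comp (h : IsSquareRel R S E) {Z : C} {u v u' v' : Z ⟶ R.obj} (huv : E.Rel u v)
    (huv' : E.Rel u' v') (hu : u ≫ R.snd = u' ≫ R.fst) (hv : v ≫ R.snd = v' ≫ R.fst) :
    ∃ u'' v'' : Z ⟶ R.obj, E.Rel u'' v'' ∧ u'' ≫ R.fst = u ≫ R.fst ∧ u'' ≫ R.snd = u' ≫ R.snd ∧
      v'' ≫ R.fst = v ≫ R.fst ∧ v'' ≫ R.snd = v' ≫ R.snd := by
  obtain ⟨q₁, q₂, h₁₁, h₁₂, h₂₁, h₂₂, hq⟩ := h.exists_horizontal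
  obtain ⟨d, rfl, rfl⟩ := huv
  obtain ⟨d', rfl, rfl⟩ := huv'
  -- Pasting is transitivity of the same object of squares, read as a relation on `S`.
  let H : EqRel S.obj := ⟨E.obj, q₁, q₂, hq⟩
  have hd : H.Rel (d ≫ q₁) (d ≫ q₂) := H.rel_self d
  have hd' : H.Rel (d' ≫ q₁) (d' ≫ q₂) := H.rel_self d'
  have e : d ≫ q₂ = d' ≫ q₁ := by
    apply S.hom_ext
    · simpa [h₁₁, h₂₁] using hu
    · simpa [h₁₂, h₂₂] using hv
  rw [← e] at hd'
  obtain ⟨t, ht₁, ht₂⟩ := hd.trans hd'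
  change t ≫ q₁ = _ at ht₁
  change t ≫ q₂ = _ at ht₂
  refine ⟨t ≫ E.fst, t ≫ E.snd, E.rel_self t, ?_, ?_, ?_, ?_⟩ <;> simp only [Category.assoc]
  · rw [← h₁₁, reassoc_of% ht₁]
  · rw [← h₂₁, reassoc_of% ht₂]
  · rw [← h₁₂, reassoc_of% ht₁]
  · rw [← h₂₂, reassoc_of% ht₂]

/-- If one vertical side of a square is trivial only when the other one is, then the squares
form a centralizing relation. -/
theorem centralize (h : IsSquareRel R S E) (hE : ∀ ⦃Z : C⦄ (u v : Z ⟶ R.obj), E.Rel u v →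
    u ≫ R.snd = v ≫ R.snd → u ≫ R.fst = v ≫ R.fst) : Centralize R S := by
  obtain ⟨q₁, q₂, h₁₁, h₁₂, h₂₁, h₂₂, hq⟩ := h.exists_horizontal
  -- Two squares with equal first row and equal second column have related second rows with the same
  -- right end, to which `hE` applies.
  have inj : ∀ {Z : C} (f g : Z ⟶ E.obj), f ≫ E.fst = g ≫ E.fst → f ≫ q₂ = g ≫ q₂ → f = g := by
    intro Z f g e₁ e₂
    apply E.hom_ext e₁
    have hs : (f ≫ E.snd) ≫ R.snd = (g ≫ E.snd) ≫ R.snd := by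
      rw [Category.assoc, Category.assoc, ← h₂₂, reassoc_of% e₂]
    refine R.hom_ext (hE _ _ ?_ hs) hs
    have hg := E.rel_self g
    rw [← e₁] at hg
    exact (E.rel_self f).symm.trans hg
  have : Mono (prod.lift E.fst q₂) := ⟨fun f g e => inj f g
    (by simpa [prod.lift_fst] using congrArg (· ≫ prod.fst) e)
    (by simpa [prod.lift_snd] using congrArg (· ≫ prod.snd) e)⟩
  -- To complete a R b, b S c to a square, apply difunctionality to (a b; a b), (b b; b b), (b b; c
  -- c): the first two share their second column, the last two their first row.
  have ex : ∀ {Z : C} (a : Z ⟶ R.obj) (b : Z ⟶ S.obj), a ≫ R.snd = b ≫ S.fst →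
      ∃ w : Z ⟶ E.obj, w ≫ E.fst = a ∧ w ≫ q₂ = b := by
    intro Z a b hab
    obtain ⟨w₁, e₁, e₁'⟩ := EqRel.Rel.refl E a
    obtain ⟨w₂, e₂, e₂'⟩ := EqRel.Rel.refl E (a ≫ R.snd ≫ R.diag)
    obtain ⟨w₃, e₃, e₃'⟩ := h.rel_diag _ _ (S.rel_self b)
    obtain ⟨w, hw, hw'⟩ := difunctional E.fst q₂ (w₁ := w₁) (w₂ := w₂) (w₃ := w₃)
      (by
        apply S.hom_ext
        · simp [h₂₁, reassoc_of% e₁, reassoc_of% e₂]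
        · simp [h₂₂, reassoc_of% e₁', reassoc_of% e₂'])
      (by rw [e₂, e₃, reassoc_of% hab, Category.assoc])
    refine ⟨w, hw.trans e₁, hw'.trans ?_⟩
    apply S.hom_ext
    · simp [h₂₁, reassoc_of% e₃]
    · simp [h₂₂, reassoc_of% e₃']
  choose l hl hl' using @ex
  exact ⟨{
    obj := E.obj
    p₁ := E.fst
    p₂ := E.snd
    q₁ := q₁
    q₂ := q₂
    isEquivalenceRelation_p := E.isEquivalenceRelation
    isEquivalenceRelation_q := hq
    comm₁₁ := h₁₁.symm
    comm₁₂ := h₁₂.symm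
    comm₂₁ := h₂₁.symm
    comm₂₂ := h₂₂.symm
    isPullback := ⟨⟨h₂₁.symm⟩, ⟨PullbackCone.IsLimit.mk _ (fun s => l s.fst s.snd s.condition)
      (fun s => hl _ _ _) (fun s => hl' _ _ _)
      (fun s m e₁ e₂ => inj _ _ (e₁.trans (hl _ _ _).symm) (e₂.trans (hl' _ _ _).symm))⟩⟩ }⟩

end IsSquareRel

namespace CentralizingRelation

/-- The underlying equivalence relation on `R` of a centralizing relation. -/
def vertical (D : CentralizingRelation R S) : EqRel R.obj where
  obj := D.obj
  fst := D.p₁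
  snd := D.p₂
  isEquivalenceRelation := D.isEquivalenceRelation_p

/-- The underlying equivalence relation on `S` of a centralizing relation. -/
def horizontal (D : CentralizingRelation R S) : EqRel S.obj where
  obj := D.obj
  fst := D.q₁
  snd := D.q₂
  isEquivalenceRelation := D.isEquivalenceRelation_q

theorem rel_vertical (D : CentralizingRelation R S) {Z : C} (u v : Z ⟶ R.obj) :
    D.vertical.Rel u v ↔ ∃ d : Z ⟶ D.obj, d ≫ D.p₁ = u ∧ d ≫ D.p₂ = v :=
  Iff.rfl

theorem rel_horizontal (D : CentralizingRelation R S) {Z : C} (u v : Z ⟶ S.obj) :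
    D.horizontal.Rel u v ↔ ∃ d : Z ⟶ D.obj, d ≫ D.q₁ = u ∧ d ≫ D.q₂ = v :=
  Iff.rfl

theorem isSquareRel (D : CentralizingRelation R S) : IsSquareRel R S D.vertical where
  rel_fst := by
    intro Z u v h
    obtain ⟨d, rfl, rfl⟩ := (D.rel_vertical _ _).1 h
    exact ⟨d ≫ D.q₁, by simp [D.comm₁₁], by simp [D.comm₁₂]⟩
  rel_snd := by
    intro Z u v h
    obtain ⟨d, rfl, rfl⟩ := (D.rel_vertical _ _).1 h
    exact ⟨d ≫ D.q₂, by simp [D.comm₂₁], by simp [D.comm₂₂]⟩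
  rel_diag := by
    rintro Z b c ⟨s, rfl, rfl⟩
    obtain ⟨d, h₁, h₂⟩ := (D.rel_horizontal _ _).1 (EqRel.Rel.refl _ s)
    refine (D.rel_vertical _ _).2 ⟨d, ?_, ?_⟩ <;> apply R.hom_ext
    · simp [D.comm₁₁, reassoc_of% h₁]
    · simp [D.comm₂₁, reassoc_of% h₂]
    · simp [D.comm₁₂, reassoc_of% h₁]
    · simp [D.comm₂₂, reassoc_of% h₂]

/-- The given square and the trivial square on `u` have the same first row and the same second
column, so the pullback property equates them. -/
theorem eq_of_rel (D : CentralizingRelation R S) {Z : C} {u v : Z ⟶ R.obj}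
    (h : D.vertical.Rel u v) (huv : u ≫ R.snd = v ≫ R.snd) : u = v := by
  obtain ⟨d, rfl, rfl⟩ := (D.rel_vertical _ _).1 h
  obtain ⟨d', h₁, h₂⟩ := (D.rel_vertical _ _).1 (EqRel.Rel.refl _ (d ≫ D.p₁))
  have : d' = d := by
    apply D.isPullback.hom_ext h₁
    apply S.hom_ext
    · simp only [Category.assoc, ← D.comm₂₁, reassoc_of% h₁]
    · simpa only [Category.assoc, ← D.comm₂₂, reassoc_of% h₂] using huv
  rw [← h₂, this]

end CentralizingRelation

end Squares

/-! ### Surjections of 2-Eq(C) and images of centralizing pairs -/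

@[simp]
theorem TwoEq.id_hom (A : TwoEq C) : TwoEq.Hom.hom (𝟙 A) = 𝟙 A.carrier := rfl

@[simp]
theorem TwoEq.comp_hom {A B D : TwoEq C} (f : A ⟶ B) (g : B ⟶ D) :
    (f ≫ g).hom = f.hom ≫ g.hom := rfl

/-- The arrow `g` is a regular epimorphism in `C` and the relations of its codomain are the direct
images of those of its domain. -/
structure TwoEq.IsSurj {A B : TwoEq C} (g : A ⟶ B) : Prop where
  isRegularEpi : IsRegularEpi g.hom
  liftsLocally_R : EqRel.LiftsLocally g.hom A.R B.R
  liftsLocally_S : EqRel.LiftsLocally g.hom A.S B.S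

section Image

variable [Regular C] [Maltsev C]

/-- The direct image of `E` along the induced arrow between the relations is again a square
relation. By local lifting, `h` becomes the criterion for this image. -/
theorem TwoEq.IsSurj.centralize {A B : TwoEq C} {g : A ⟶ B} (hg : TwoEq.IsSurj g)
    {E : EqRel A.R.obj} (hE : IsSquareRel A.R A.S E)
    (h : ∀ ⦃Z : C⦄ (u v : Z ⟶ A.R.obj), E.Rel u v →
      u ≫ A.R.snd ≫ g.hom = v ≫ A.R.snd ≫ g.hom → u ≫ A.R.fst ≫ g.hom = v ≫ A.R.fst ≫ g.hom) :
    Centralize B.R B.S := by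
  obtain ⟨r, hr₁, hr₂⟩ := g.respects_R
  have : IsRegularEpi r := by
    obtain ⟨Z, p, x, y, hp, ⟨t, rfl, rfl⟩, hx, hy⟩ :=
      hg.liftsLocally_R B.R.fst B.R.snd ⟨𝟙 _, by simp, by simp⟩
    refine isRegularEpi_of_local_lift r ⟨Z, p, t, hp, B.R.hom_ext ?_ ?_⟩
    · simpa [hr₁] using hx
    · simpa [hr₂] using hy
  have lift := EqRel.liftsLocally_directImage r E
  have resp := EqRel.respects_iff.1 (E.respects_directImage r)
  have hS := EqRel.respects_iff.1 g.respects_S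
  have hE' : IsSquareRel B.R B.S (E.directImage r) := {
    rel_fst := by
      intro Z u v huv
      obtain ⟨Z', p, x, y, hp, hxy, hx, hy⟩ := lift u v huv
      apply EqRel.Rel.of_cover p
      rw [← reassoc_of% hx, ← reassoc_of% hy, hr₁]
      simpa using hS _ _ (hE.rel_fst _ _ hxy)
    rel_snd := by
      intro Z u v huv
      obtain ⟨Z', p, x, y, hp, hxy, hx, hy⟩ := lift u v huv
      apply EqRel.Rel.of_cover p
      rw [← reassoc_of% hx, ← reassoc_of% hy, hr₂]
      simpa using hS _ _ (hE.rel_snd _ _ hxy)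
    rel_diag := by
      intro Z b c hbc
      obtain ⟨Z', p, x, y, hp, hxy, hx, hy⟩ := hg.liftsLocally_S b c hbc
      have key : ∀ (x : Z' ⟶ A.carrier) (b : Z ⟶ B.carrier), x ≫ g.hom = p ≫ b →
          (x ≫ A.R.diag) ≫ r = p ≫ b ≫ B.R.diag := by
        intro x b hx
        apply B.R.hom_ext
        · simp [hr₁, hx]
        · simp [hr₂, hx]
      apply EqRel.Rel.of_cover p
      rw [← key x b hx, ← key y c hy]
      exact resp _ _ (hE.rel_diag _ _ hxy) }
  refine hE'.centralize fun Z u v huv e => ?_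
  obtain ⟨Z', p, x, y, hp, hxy, hx, hy⟩ := lift u v huv
  have := h x y hxy (by
    rw [← hr₂, reassoc_of% hx, reassoc_of% hy, e])
  rw [← hr₁, reassoc_of% hx, reassoc_of% hy] at this
  have hp' : Epi p := inferInstance
  exact hp'.left_cancellation _ _ this

/-- Regular images of centralizing equivalence relations centralize each other. -/
theorem TwoEq.IsSurj.centralize_of_centralize {A B : TwoEq C} {g : A ⟶ B} (hg : TwoEq.IsSurj g)
    (h : Centralize A.R A.S) : Centralize B.R B.S := by
  obtain ⟨D⟩ := h
  refine hg.centralize D.isSquareRel fun Z u v huv e => ?_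
  obtain ⟨d, hd₁, hd₂⟩ := (D.rel_vertical _ _).1 huv
  obtain ⟨r, hr₁, hr₂⟩ := g.respects_R
  -- The equalizer consists of the squares whose two rows have the same image. First row and second
  -- column still determine such a square, so difunctionality applies to it.
  have inj : ∀ {Z : C} (a b : Z ⟶ equalizer (D.p₁ ≫ r) (D.p₂ ≫ r)),
      a ≫ equalizer.ι (D.p₁ ≫ r) (D.p₂ ≫ r) ≫ D.p₁ =
        b ≫ equalizer.ι (D.p₁ ≫ r) (D.p₂ ≫ r) ≫ D.p₁ →
      a ≫ equalizer.ι (D.p₁ ≫ r) (D.p₂ ≫ r) ≫ D.q₂ =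
        b ≫ equalizer.ι (D.p₁ ≫ r) (D.p₂ ≫ r) ≫ D.q₂ → a = b := by
    intro Z a b h₁ h₂
    apply equalizer.hom_ext
    apply D.isPullback.hom_ext
    · simpa using h₁
    · simpa using h₂
  have : Mono (prod.lift (equalizer.ι (D.p₁ ≫ r) (D.p₂ ≫ r) ≫ D.p₁)
      (equalizer.ι (D.p₁ ≫ r) (D.p₂ ≫ r) ≫ D.q₂)) := ⟨fun a b e => inj a b
    (by simpa [prod.lift_fst] using congrArg (· ≫ prod.fst) e)
    (by simpa [prod.lift_snd] using congrArg (· ≫ prod.snd) e)⟩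
  -- For `d` = (a b; d' c), these are (a b; a b), (b b; b b), (b b; c c). The last lies in the
  -- equalizer because b and c have the same image. The resulting square in the equalizer must be
  -- `d` itself.
  obtain ⟨d₁, e₁, e₁'⟩ := (D.rel_vertical _ _).1 (EqRel.Rel.refl _ u)
  obtain ⟨d₂, e₂, e₂'⟩ := (D.rel_vertical _ _).1 (EqRel.Rel.refl _ (u ≫ A.R.snd ≫ A.R.diag))
  obtain ⟨d₃, e₃, e₃'⟩ := (D.rel_vertical _ _).1
    (D.isSquareRel.rel_diag _ _ (D.isSquareRel.rel_snd _ _ huv))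
  obtain ⟨w, hw, hw'⟩ := difunctional (equalizer.ι (D.p₁ ≫ r) (D.p₂ ≫ r) ≫ D.p₁)
    (equalizer.ι (D.p₁ ≫ r) (D.p₂ ≫ r) ≫ D.q₂)
    (w₁ := equalizer.lift d₁ (by rw [reassoc_of% e₁, reassoc_of% e₁']))
    (w₂ := equalizer.lift d₂ (by rw [reassoc_of% e₂, reassoc_of% e₂']))
    (w₃ := equalizer.lift d₃ (by
      rw [reassoc_of% e₃, reassoc_of% e₃']
      apply B.R.hom_ext
      · simp [hr₁, e]
      · simp [hr₂, e]))
    (by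
      apply A.S.hom_ext
      · simp [← D.comm₂₁, reassoc_of% e₁, reassoc_of% e₂]
      · simp [← D.comm₂₂, reassoc_of% e₁', reassoc_of% e₂'])
    (by simp [e₂, e₃])
  simp only [equalizer.lift_ι_assoc] at hw hw'
  have hwd : w ≫ equalizer.ι (D.p₁ ≫ r) (D.p₂ ≫ r) = d := by
    apply D.isPullback.hom_ext
    · rw [Category.assoc, hw, e₁, hd₁]
    · rw [Category.assoc, hw']
      apply A.S.hom_ext
      · simp [← D.comm₂₁, reassoc_of% e₃, reassoc_of% hd₁]
      · simp [← D.comm₂₂, reassoc_of% e₃', reassoc_of% hd₂]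
  have hdr : u ≫ r = v ≫ r := by
    rw [← hd₁, ← hd₂, Category.assoc, Category.assoc, ← hwd, Category.assoc, Category.assoc,
      equalizer.condition]
  rw [← hr₁, reassoc_of% hdr]

theorem TwoEq.isSurj_toQuotient [HasCoequalizers C] (A : TwoEq C) (T : EqRel A.carrier) :
    TwoEq.IsSurj (A.toQuotient T) where
  isRegularEpi := inferInstanceAs (IsRegularEpi T.quotientMap)
  liftsLocally_R := EqRel.liftsLocally_directImage T.quotientMap A.R
  liftsLocally_S := EqRel.liftsLocally_directImage T.quotientMap A.S

end Image

/-! ### Construction of the commutator -/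

section Commutator

variable [Maltsev C] [HasCoequalizers C] {X : C}

/-- The equivalence relation on `R` generated by the pairs `((b, b), (c, c))` with `b S c`. -/
noncomputable def EqRel.squares (R S : EqRel X) : EqRel R.obj :=
  EqRel.ker (coequalizer.π (S.fst ≫ R.diag) (S.snd ≫ R.diag))

theorem exists_section_commutator (R S : EqRel X) :
    ∃ k : X ⟶ equalizer ((R.squares S).fst ≫ R.snd) ((R.squares S).snd ≫ R.snd),
      k ≫ equalizer.ι _ _ ≫ (R.squares S).fst ≫ R.fst = 𝟙 X ∧
      k ≫ equalizer.ι _ _ ≫ (R.squares S).snd ≫ R.fst = 𝟙 X := by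
  obtain ⟨d, h₁, h₂⟩ := EqRel.Rel.refl (R.squares S) R.diag
  refine ⟨equalizer.lift d (by rw [reassoc_of% h₁, reassoc_of% h₂]), ?_, ?_⟩
  · simp [reassoc_of% h₁]
  · simp [reassoc_of% h₂]

variable [BarrExact C]

/-- Minimality of the generated relation: the quotient by `F`, precomposed with `r`, coequalizes the
generators, hence factors through their coequalizer. Exactness recovers `F` from its quotient. -/
theorem EqRel.rel_of_squares {R S : EqRel X} {Q : C} (r : R.obj ⟶ Q) (F : EqRel Q)
    (h : F.Rel (S.fst ≫ R.diag ≫ r) (S.snd ≫ R.diag ≫ r)) {Z : C} {u v : Z ⟶ R.obj}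
    (huv : (R.squares S).Rel u v) : F.Rel (u ≫ r) (v ≫ r) := by
  rw [EqRel.rel_iff_quotientMap] at h ⊢
  rw [EqRel.squares, EqRel.rel_ker] at huv
  have hd : (S.fst ≫ R.diag) ≫ r ≫ F.quotientMap = (S.snd ≫ R.diag) ≫ r ≫ F.quotientMap := by
    simpa using h
  rw [Category.assoc, Category.assoc, ← coequalizer.π_desc _ hd, reassoc_of% huv]

theorem isSquareRel_squares (R S : EqRel X) : IsSquareRel R S (R.squares S) := by
  have hS : S.Rel S.fst S.snd := ⟨𝟙 _, by simp, by simp⟩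
  refine ⟨fun Z u v h => EqRel.rel_of_squares _ _ (by simpa using hS) h,
    fun Z u v h => EqRel.rel_of_squares _ _ (by simpa using hS) h, ?_⟩
  rintro Z b c ⟨s, rfl, rfl⟩
  rw [EqRel.squares, EqRel.rel_ker]
  simpa using congrArg (s ≫ ·) (coequalizer.condition (S.fst ≫ R.diag) (S.snd ≫ R.diag))

/-- The commutator of `R` and `S`: the pairs `(a, d)` such that, locally, there is a square
`(a b; d b)` in the equivalence relation generated by the squares `(b b; c c)` with `b S c`. -/
noncomputable def EqRel.commutator (R S : EqRel X) : EqRel X :=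
  EqRel.ofPair _ _ (exists_section_commutator R S)

theorem EqRel.rel_commutator (R S : EqRel X) {Z : C} (a d : Z ⟶ X) :
    (R.commutator S).Rel a d ↔ ∃ (Z' : C) (p : Z' ⟶ Z) (u v : Z' ⟶ R.obj), IsRegularEpi p ∧
      (R.squares S).Rel u v ∧ u ≫ R.snd = v ≫ R.snd ∧ u ≫ R.fst = p ≫ a ∧
      v ≫ R.fst = p ≫ d := by
  rw [EqRel.commutator, EqRel.rel_ofPair]
  constructor
  · rintro ⟨Z', p, k, hp, h₁, h₂⟩
    refine ⟨Z', p, (k ≫ equalizer.ι _ _) ≫ (R.squares S).fst,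
      (k ≫ equalizer.ι _ _) ≫ (R.squares S).snd, hp, EqRel.rel_self _ _, ?_, ?_, ?_⟩
    · rw [Category.assoc, Category.assoc, Category.assoc, Category.assoc, equalizer.condition]
    · simpa using h₁
    · simpa using h₂
  · rintro ⟨Z', p, u, v, hp, ⟨g, rfl, rfl⟩, h, h₁, h₂⟩
    exact ⟨Z', p, equalizer.lift g (by simpa using h), hp, by simpa using h₁, by simpa using h₂⟩

/-- From a square (a b; d b) one reads a R b and d R b. Containment in both relations is later used
to lift related pairs to the comparison arrow's domain. -/
theorem EqRel.commutator_le_left (R S : EqRel X) {Z : C} {a d : Z ⟶ X}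
    (h : (R.commutator S).Rel a d) : R.Rel a d := by
  obtain ⟨Z', p, u, v, hp, -, hs, h₁, h₂⟩ := (EqRel.rel_commutator _ _ _ _).1 h
  apply EqRel.Rel.of_cover p
  rw [← h₁, ← h₂]
  have hu := R.rel_self u
  rw [hs] at hu
  exact hu.trans (R.rel_self v).symm

theorem EqRel.commutator_le_right (R S : EqRel X) {Z : C} {a d : Z ⟶ X}
    (h : (R.commutator S).Rel a d) : S.Rel a d := by
  obtain ⟨Z', p, u, v, hp, hq, -, h₁, h₂⟩ := (EqRel.rel_commutator _ _ _ _).1 h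
  apply EqRel.Rel.of_cover p
  rw [← h₁, ← h₂]
  exact (isSquareRel_squares R S).rel_fst _ _ hq

/-- An arrow to a pair of centralizing relations identifies elements related by the commutator. -/
theorem TwoEq.eq_of_commutator {A B : TwoEq C} (g : A ⟶ B) (hB : Centralize B.R B.S) {Z : C}
    {a d : Z ⟶ A.carrier} (h : (A.R.commutator A.S).Rel a d) : a ≫ g.hom = d ≫ g.hom := by
  obtain ⟨Z', p, u, v, hp, hq, hs, h₁, h₂⟩ := (EqRel.rel_commutator _ _ _ _).1 h
  obtain ⟨D⟩ := hB
  obtain ⟨r, hr₁, hr₂⟩ := g.respects_R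
  have hr : A.R.diag ≫ r = g.hom ≫ B.R.diag := by
    apply B.R.hom_ext
    · simp [hr₁]
    · simp [hr₂]
  -- The generating squares land in `D`, hence so do all generated ones.
  have key : D.vertical.Rel (u ≫ r) (v ≫ r) := by
    refine EqRel.rel_of_squares r D.vertical ?_ hq
    rw [hr, ← Category.assoc, ← Category.assoc]
    exact D.isSquareRel.rel_diag _ _ (EqRel.respects_iff.1 g.respects_S _ _
      ⟨𝟙 _, by simp, by simp⟩)
  have huv := D.eq_of_rel key (by simp only [Category.assoc, hr₂, reassoc_of% hs])
  have hp' : Epi p := inferInstance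
  apply hp'.left_cancellation
  rw [← reassoc_of% h₁, ← reassoc_of% h₂, ← hr₁, reassoc_of% huv]

/-- Suppose b and c become equal in the quotient, for a square (a b; d c). Locally there is a square
(b e; c e); pasting gives (a e; d e), so a and d become equal too. -/
theorem TwoEq.centralize_quotient_commutator (A : TwoEq C) :
    Centralize (A.quotient (A.R.commutator A.S)).R (A.quotient (A.R.commutator A.S)).S := by
  have hE := isSquareRel_squares A.R A.S
  refine (A.isSurj_toQuotient (A.R.commutator A.S)).centralize hE fun Z u v huv e => ?_
  have key : ∀ ⦃Z : C⦄ (a b : Z ⟶ A.carrier), (A.R.commutator A.S).Rel a b ↔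
      a ≫ (A.toQuotient (A.R.commutator A.S)).hom = b ≫ (A.toQuotient (A.R.commutator A.S)).hom :=
    fun _ a b => EqRel.rel_iff_quotientMap _ a b
  rw [← Category.assoc, ← Category.assoc, ← key, EqRel.rel_commutator] at e ⊢
  obtain ⟨Z', p, u', v', hp, huv', hs, h₁, h₂⟩ := e
  obtain ⟨u'', v'', h, h₁₁, h₁₂, h₂₁, h₂₂⟩ := hE.comp (huv.precomp p) huv'
    (by simpa using h₁.symm) (by simpa using h₂.symm)
  exact ⟨Z', p, u'', v'', hp, h, by rw [h₁₂, h₂₂, hs], by simpa using h₁₁, by simpa using h₂₁⟩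

theorem TwoEq.isCommutator_commutator (A : TwoEq C) :
    IsCommutator A.R A.S (A.R.commutator A.S) where
  centralize := A.centralize_quotient_commutator
  le T' h := by
    rw [EqRel.le_iff]
    intro Z a b hab
    rw [EqRel.rel_iff_quotientMap]
    exact TwoEq.eq_of_commutator (A.toQuotient T') h hab

end Commutator

/-- Kernel pairs permute: if `f x = f u` and `g u = g v`, then locally there is `w` with
`g w = g x` and `f w = f v`. -/
theorem exists_local_permute [Regular C] [Maltsev C] {X Y Y' Z : C} (g : X ⟶ Y)
    (f : X ⟶ Y') {x u v : Z ⟶ X} (hxu : x ≫ f = u ≫ f) (huv : u ≫ g = v ≫ g) :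
    ∃ (Z' : C) (p : Z' ⟶ Z) (w : Z' ⟶ X), IsRegularEpi p ∧ w ≫ g = p ≫ x ≫ g ∧
      w ≫ f = p ≫ v ≫ f := by
  -- The image of (g, f) is a relation from `Y` to `Y'`, to which difunctionality applies; its
  -- elements lift locally to `X`.
  let F := Regular.strongEpiMonoFactorisation (prod.lift g f)
  have : IsRegularEpi F.e := isRegularEpi_of_strongEpi _
  have h₁ : F.e ≫ F.m ≫ prod.fst = g := by rw [← Category.assoc, F.fac, prod.lift_fst]
  have h₂ : F.e ≫ F.m ≫ prod.snd = f := by rw [← Category.assoc, F.fac, prod.lift_snd]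
  have : Mono (prod.lift (F.m ≫ prod.fst) (F.m ≫ prod.snd)) := by
    rw [← prod.comp_lift, prod.lift_fst_snd, Category.comp_id]
    infer_instance
  obtain ⟨t, ht₁, ht₂⟩ := difunctional (F.m ≫ prod.fst) (F.m ≫ prod.snd) (w₁ := x ≫ F.e)
    (w₂ := u ≫ F.e) (w₃ := v ≫ F.e) (by simp only [Category.assoc, h₂, hxu])
    (by simp only [Category.assoc, h₁, huv])
  obtain ⟨Z', p, w, hp, hw⟩ := exists_local_lift F.e t
  refine ⟨Z', p, w, hp, ?_, ?_⟩
  · rw [← h₁, reassoc_of% hw, ht₁, Category.assoc]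
  · rw [← h₂, reassoc_of% hw, ht₂, Category.assoc]

/-! ### Regular epimorphisms and pullbacks in 2-Eq(C) -/

namespace TwoEq

variable {A B D : TwoEq C}

theorem hom_ext {f g : A ⟶ B} (h : f.hom = g.hom) : f = g :=
  TwoEq.Hom.ext h

section RegularEpi

theorem IsSurj.cancel {g : A ⟶ B} (hg : IsSurj g) {k l : B ⟶ D} (h : g ≫ k = g ≫ l) : k = l := by
  have := hg.isRegularEpi
  exact hom_ext ((cancel_epi g.hom).1 (congrArg Hom.hom h))

variable [Regular C]

theorem IsSurj.comp {f : A ⟶ B} {g : B ⟶ D} (hf : IsSurj f) (hg : IsSurj g) :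
    IsSurj (f ≫ g) := by
  have key : ∀ {R : EqRel A.carrier} {S : EqRel B.carrier} {T : EqRel D.carrier},
      EqRel.LiftsLocally f.hom R S → EqRel.LiftsLocally g.hom S T →
        EqRel.LiftsLocally (f ≫ g).hom R T := by
    intro R S T h k Z a b hab
    obtain ⟨Z', p, x, y, hp, hxy, hx, hy⟩ := k a b hab
    obtain ⟨Z'', p', x', y', hp', hxy', hx', hy'⟩ := h x y hxy
    refine ⟨Z'', p' ≫ p, x', y', isRegularEpi_comp _ _ hp' hp, hxy', ?_, ?_⟩
    · rw [comp_hom, reassoc_of% hx', hx, Category.assoc]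
    · rw [comp_hom, reassoc_of% hy', hy, Category.assoc]
  exact ⟨isRegularEpi_comp _ _ hf.isRegularEpi hg.isRegularEpi,
    key hf.liftsLocally_R hg.liftsLocally_R, key hf.liftsLocally_S hg.liftsLocally_S⟩

theorem IsSurj.of_comp {f : A ⟶ B} {g : B ⟶ D} (h : IsSurj (f ≫ g)) : IsSurj g := by
  have key : ∀ {R : EqRel A.carrier} {S : EqRel B.carrier} {T : EqRel D.carrier},
      EqRel.LiftsLocally (f ≫ g).hom R T → EqRel.Respects f.hom R S →
        EqRel.LiftsLocally g.hom S T := by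
    intro R S T h k Z a b hab
    obtain ⟨Z', p, x, y, hp, hxy, hx, hy⟩ := h a b hab
    exact ⟨Z', p, x ≫ f.hom, y ≫ f.hom, hp, EqRel.respects_iff.1 k _ _ hxy,
      by simpa using hx, by simpa using hy⟩
  exact ⟨isRegularEpi_of_comp f.hom g.hom h.isRegularEpi,
    key h.liftsLocally_R f.respects_R, key h.liftsLocally_S f.respects_S⟩

theorem isSurj_id (A : TwoEq C) : IsSurj (𝟙 A) where
  isRegularEpi := inferInstanceAs (IsRegularEpi (𝟙 A.carrier))
  liftsLocally_R Z a b h := ⟨Z, 𝟙 Z, a, b, inferInstance, h, by simp, by simp⟩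
  liftsLocally_S Z a b h := ⟨Z, 𝟙 Z, a, b, inferInstance, h, by simp, by simp⟩

theorem isSurj_of_isIso (f : A ⟶ B) [IsIso f] : IsSurj f :=
  IsSurj.of_comp (f := inv f) (by rw [IsIso.inv_hom_id]; exact isSurj_id B)

/-- An arrow descends along a surjection if it identifies the elements which the surjection
identifies. -/
theorem IsSurj.exists_desc {g : A ⟶ B} (hg : IsSurj g) (h : A ⟶ D)
    (H : ∀ ⦃Z : C⦄ (a b : Z ⟶ A.carrier), a ≫ g.hom = b ≫ g.hom → a ≫ h.hom = b ≫ h.hom) :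
    ∃ k : B ⟶ D, g ≫ k = h := by
  have := hg.isRegularEpi
  obtain ⟨k, hk⟩ : ∃ k, g.hom ≫ k = h.hom :=
    ⟨_, IsRegularEpi.fac g.hom h.hom (H _ _ (IsRegularEpi.w g.hom))⟩
  exact ⟨⟨k, hg.liftsLocally_R.respects (by rw [hk]; exact h.respects_R),
    hg.liftsLocally_S.respects (by rw [hk]; exact h.respects_S)⟩, hom_ext hk⟩

variable [Maltsev C]

theorem IsSurj.isRegularEpi_twoEq {g : A ⟶ B} (hg : IsSurj g) : IsRegularEpi g := by
  -- Discrete relations suffice on the kernel pair: every arrow out of it respects them, and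
  -- coequalizing is a condition in `C` alone.
  let K : TwoEq C := ⟨pullback g.hom g.hom, EqRel.discrete _, EqRel.discrete _⟩
  let l : K ⟶ A := ⟨pullback.fst g.hom g.hom, EqRel.respects_discrete _ _,
    EqRel.respects_discrete _ _⟩
  let r : K ⟶ A := ⟨pullback.snd g.hom g.hom, EqRel.respects_discrete _ _,
    EqRel.respects_discrete _ _⟩
  have w : l ≫ g = r ≫ g := hom_ext pullback.condition
  have ex : ∀ s : Cofork l r, ∃ k : B ⟶ s.pt, g ≫ k = s.π := fun s => by
    refine hg.exists_desc s.π fun Z a b hab => ?_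
    have hs : pullback.fst g.hom g.hom ≫ s.π.hom = pullback.snd g.hom g.hom ≫ s.π.hom :=
      congrArg Hom.hom s.condition
    rw [← pullback.lift_fst a b hab, Category.assoc, hs, pullback.lift_snd_assoc]
  choose k hk using ex
  exact ⟨⟨⟨K, l, r, w, Cofork.IsColimit.mk _ k hk
    fun s m hm => hg.cancel ((show g ≫ m = s.π from hm).trans (hk s).symm)⟩⟩⟩

/-- Factor `g` through its image in `C` with the direct image relations. The second factor is monic
and `g` is a strong epimorphism, so that factor is an isomorphism. -/
theorem isSurj_of_isRegularEpi (g : A ⟶ B) [IsRegularEpi g] : IsSurj g := by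
  let F := Regular.strongEpiMonoFactorisation g.hom
  have : IsRegularEpi F.e := isRegularEpi_of_strongEpi _
  let I : TwoEq C := ⟨F.I, A.R.directImage F.e, A.S.directImage F.e⟩
  let e : A ⟶ I := ⟨F.e, A.R.respects_directImage F.e, A.S.respects_directImage F.e⟩
  have he : IsSurj e := ⟨this, EqRel.liftsLocally_directImage _ _,
    EqRel.liftsLocally_directImage _ _⟩
  let m : I ⟶ B := ⟨F.m,
    he.liftsLocally_R.respects (by
      change EqRel.Respects (F.e ≫ F.m) _ _
      rw [F.fac]
      exact g.respects_R),
    he.liftsLocally_S.respects (by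
      change EqRel.Respects (F.e ≫ F.m) _ _
      rw [F.fac]
      exact g.respects_S)⟩
  have hm : Mono m := ⟨fun a b h => hom_ext ((cancel_mono F.m).1 (congrArg Hom.hom h))⟩
  have hg : e ≫ m = g := hom_ext F.fac
  have : StrongEpi g := inferInstance
  have : IsIso m := ExtremalEpi.isIso g e m hg
  rw [← hg]
  exact he.comp (isSurj_of_isIso m)

end RegularEpi

section Pullback

variable [Maltsev C]

/-- The pullback of two arrows of `2-Eq(C)`, with the relations computed componentwise. -/
noncomputable def pullback (h : A ⟶ D) (k : B ⟶ D) : TwoEq C where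
  carrier := Limits.pullback h.hom k.hom
  R := (A.R.comap (pullback.fst h.hom k.hom)).inf (B.R.comap (pullback.snd h.hom k.hom))
  S := (A.S.comap (pullback.fst h.hom k.hom)).inf (B.S.comap (pullback.snd h.hom k.hom))

/-- The first projection. -/
noncomputable def pullbackFst (h : A ⟶ D) (k : B ⟶ D) : pullback h k ⟶ A where
  hom := pullback.fst h.hom k.hom
  respects_R := EqRel.respects_iff.2 fun _ _ _ H =>
    (EqRel.rel_comap _ _ _ _).1 ((EqRel.rel_inf _ _ _ _).1 H).1
  respects_S := EqRel.respects_iff.2 fun _ _ _ H =>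
    (EqRel.rel_comap _ _ _ _).1 ((EqRel.rel_inf _ _ _ _).1 H).1

/-- The second projection. -/
noncomputable def pullbackSnd (h : A ⟶ D) (k : B ⟶ D) : pullback h k ⟶ B where
  hom := pullback.snd h.hom k.hom
  respects_R := EqRel.respects_iff.2 fun _ _ _ H =>
    (EqRel.rel_comap _ _ _ _).1 ((EqRel.rel_inf _ _ _ _).1 H).2
  respects_S := EqRel.respects_iff.2 fun _ _ _ H =>
    (EqRel.rel_comap _ _ _ _).1 ((EqRel.rel_inf _ _ _ _).1 H).2

theorem pullback_hom_ext {h : A ⟶ D} {k : B ⟶ D} {Z : C} {a b : Z ⟶ (pullback h k).carrier}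
    (h₁ : a ≫ (pullbackFst h k).hom = b ≫ (pullbackFst h k).hom)
    (h₂ : a ≫ (pullbackSnd h k).hom = b ≫ (pullbackSnd h k).hom) : a = b :=
  Limits.pullback.hom_ext h₁ h₂

theorem isPullback (h : A ⟶ D) (k : B ⟶ D) :
    IsPullback (pullbackFst h k) (pullbackSnd h k) h k := by
  have w : pullbackFst h k ≫ h = pullbackSnd h k ≫ k := hom_ext pullback.condition
  have ex : ∀ s : PullbackCone h k, ∃ l : s.pt ⟶ pullback h k,
      l ≫ pullbackFst h k = s.fst ∧ l ≫ pullbackSnd h k = s.snd := by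
    intro s
    have hs : s.fst.hom ≫ h.hom = s.snd.hom ≫ k.hom := congrArg Hom.hom s.condition
    have key : ∀ {Z : C} (a : Z ⟶ s.pt.carrier),
        (a ≫ pullback.lift _ _ hs) ≫ pullback.fst h.hom k.hom = a ≫ s.fst.hom ∧
        (a ≫ pullback.lift _ _ hs) ≫ pullback.snd h.hom k.hom = a ≫ s.snd.hom := by
      intro Z a
      rw [Category.assoc, Category.assoc, pullback.lift_fst, pullback.lift_snd]
      exact ⟨rfl, rfl⟩
    refine ⟨⟨pullback.lift _ _ hs, ?_, ?_⟩, hom_ext (pullback.lift_fst _ _ _),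
      hom_ext (pullback.lift_snd _ _ _)⟩
    · refine EqRel.respects_iff.2 fun Z a b hab => ?_
      refine (EqRel.rel_inf _ _ _ _).2 ⟨(EqRel.rel_comap _ _ _ _).2 ?_,
        (EqRel.rel_comap _ _ _ _).2 ?_⟩
      · have := EqRel.respects_iff.1 s.fst.respects_R _ _ hab
        rwa [← (key a).1, ← (key b).1] at this
      · have := EqRel.respects_iff.1 s.snd.respects_R _ _ hab
        rwa [← (key a).2, ← (key b).2] at this
    · refine EqRel.respects_iff.2 fun Z a b hab => ?_
      refine (EqRel.rel_inf _ _ _ _).2 ⟨(EqRel.rel_comap _ _ _ _).2 ?_,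
        (EqRel.rel_comap _ _ _ _).2 ?_⟩
      · have := EqRel.respects_iff.1 s.fst.respects_S _ _ hab
        rwa [← (key a).1, ← (key b).1] at this
      · have := EqRel.respects_iff.1 s.snd.respects_S _ _ hab
        rwa [← (key a).2, ← (key b).2] at this
  choose l hl hl' using ex
  refine ⟨⟨w⟩, ⟨PullbackCone.IsLimit.mk _ l hl hl' fun s m e₁ e₂ => hom_ext ?_⟩⟩
  exact pullback.hom_ext (congrArg Hom.hom (e₁.trans (hl s).symm))
    (congrArg Hom.hom (e₂.trans (hl' s).symm))

end Pullback

/-- The arrow `g` is, up to isomorphism, the quotient by the commutator: a surjection onto a pair of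
centralizing relations whose kernel pair is contained in both relations of the domain and in the
kernel pair of every arrow to a pair of centralizing relations. -/
structure IsCentralization (g : A ⟶ B) : Prop where
  isSurj : IsSurj g
  centralize : Centralize B.R B.S
  rel_R : ∀ ⦃Z : C⦄ (a b : Z ⟶ A.carrier), a ≫ g.hom = b ≫ g.hom → A.R.Rel a b
  rel_S : ∀ ⦃Z : C⦄ (a b : Z ⟶ A.carrier), a ≫ g.hom = b ≫ g.hom → A.S.Rel a b
  eq_of_eq : ∀ ⦃B' : TwoEq C⦄ (h : A ⟶ B'), Centralize B'.R B'.S →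
    ∀ ⦃Z : C⦄ (a b : Z ⟶ A.carrier), a ≫ g.hom = b ≫ g.hom → a ≫ h.hom = b ≫ h.hom

/-! ### Centralizations and their universal property -/

section Exact

variable [BarrExact C] [Maltsev C] [HasCoequalizers C]

/-- Minimality puts `T` below the constructed commutator, and every kernel pair condition passes to
smaller relations. -/
theorem isCentralization_toQuotient (A : TwoEq C) (T : EqRel A.carrier)
    (hT : IsCommutator A.R A.S T) : IsCentralization (A.toQuotient T) := by
  have hle := EqRel.le_iff.1 (hT.le _ A.isCommutator_commutator.centralize)
  have key : ∀ ⦃Z : C⦄ (a b : Z ⟶ A.carrier), a ≫ (A.toQuotient T).hom = b ≫ (A.toQuotient T).hom →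
      (A.R.commutator A.S).Rel a b :=
    fun Z a b h => hle a b ((EqRel.rel_iff_quotientMap T a b).2 h)
  exact {
    isSurj := A.isSurj_toQuotient T
    centralize := hT.centralize
    rel_R := fun Z a b h => EqRel.commutator_le_left _ _ (key a b h)
    rel_S := fun Z a b h => EqRel.commutator_le_right _ _ (key a b h)
    eq_of_eq := fun B' k hk Z a b h => eq_of_commutator k hk (key a b h) }

/-- The universal property makes `g` isomorphic to the quotient by the constructed commutator. -/
theorem isCentralization_of_universal (g : A ⟶ B) (hB : Centralize B.R B.S)
    (hex : ∀ ⦃B' : TwoEq C⦄ (h : A ⟶ B'), Centralize B'.R B'.S → ∃ k : B ⟶ B', g ≫ k = h)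
    (hext : ∀ k k' : B ⟶ B, g ≫ k = g ≫ k' → k = k') : IsCentralization g := by
  have hq := A.isCentralization_toQuotient _ A.isCommutator_commutator
  obtain ⟨i, hi⟩ := hq.isSurj.exists_desc g (hq.eq_of_eq g hB)
  obtain ⟨j, hj⟩ := hex (A.toQuotient _) hq.centralize
  have hij : i ≫ j = 𝟙 _ := hq.isSurj.cancel (by rw [reassoc_of% hi, hj, Category.comp_id])
  have hji : j ≫ i = 𝟙 _ := hext _ _ (by rw [reassoc_of% hj, hi, Category.comp_id])
  have : IsIso i := ⟨j, hij, hji⟩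
  have key : ∀ ⦃Z : C⦄ (a b : Z ⟶ A.carrier), a ≫ g.hom = b ≫ g.hom →
      a ≫ (A.toQuotient (A.R.commutator A.S)).hom =
        b ≫ (A.toQuotient (A.R.commutator A.S)).hom := by
    intro Z a b h
    rw [← hj, comp_hom, reassoc_of% h]
  refine ⟨?_, hB, fun Z a b h => hq.rel_R _ _ (key a b h), fun Z a b h => hq.rel_S _ _ (key a b h),
    fun B' k hk Z a b h => hq.eq_of_eq k hk a b (key a b h)⟩
  rw [← hi]
  exact hq.isSurj.comp (isSurj_of_isIso i)

/-! ### The regular pushout property -/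

section Square

variable {A' B' : TwoEq C} {f : A ⟶ A'} {g : A ⟶ B} {g' : A' ⟶ B'}

/-- Along a surjection, the kernel pair of a centralization maps onto that of a
centralization. -/
theorem IsCentralization.exists_lift_of_eq (hf : IsSurj f) (hg : IsCentralization g)
    (hg' : IsCentralization g') {Z : C} {a b : Z ⟶ A'.carrier} (h : a ≫ g'.hom = b ≫ g'.hom) :
    ∃ (Z' : C) (p : Z' ⟶ Z) (x y : Z' ⟶ A.carrier), IsRegularEpi p ∧ x ≫ g.hom = y ≫ g.hom ∧
      x ≫ f.hom = p ≫ a ∧ y ≫ f.hom = p ≫ b := by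
  have := hf.isRegularEpi
  -- The quotient of `A'` by the image of the kernel pair of `g` is a surjective image of `B`, hence
  -- centralizing. So the kernel pair of `g'` is contained in `F`.
  let F := (EqRel.ker g.hom).directImage f.hom
  obtain ⟨k, hk⟩ := hg.isSurj.exists_desc (f ≫ A'.toQuotient F) fun Z x y e => by
    have e' := EqRel.respects_iff.1 ((EqRel.ker g.hom).respects_directImage f.hom) x y
      ((EqRel.rel_ker _ _ _).2 e)
    have := (EqRel.rel_iff_quotientMap F _ _).1 e'
    rw [Category.assoc, Category.assoc] at this
    exact this
  have hk' : IsSurj k := IsSurj.of_comp (f := g) (by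
    rw [hk]; exact hf.comp (A'.isSurj_toQuotient F))
  have hF := (EqRel.rel_iff_quotientMap F a b).2
    (hg'.eq_of_eq (A'.toQuotient F) (hk'.centralize_of_centralize hg.centralize) a b h)
  obtain ⟨Z', p, x, y, hp, hxy, hx, hy⟩ := EqRel.liftsLocally_directImage f.hom _ a b hF
  exact ⟨Z', p, x, y, hp, (EqRel.rel_ker _ _ _).1 hxy, hx, hy⟩

theorem IsCentralization.isRegularPushout (hf : IsSurj f) (hg : IsCentralization g)
    (hg' : IsCentralization g') {k : B ⟶ B'} (w : f ≫ g' = g ≫ k) :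
    IsRegularPushout f g g' k := by
  have hk : IsSurj k := IsSurj.of_comp (f := g) (by rw [← w]; exact hf.comp hg'.isSurj)
  have w' : f.hom ≫ g'.hom = g.hom ≫ k.hom := congrArg Hom.hom w
  have hP := isPullback g' k
  have hw : (pullbackFst g' k).hom ≫ g'.hom = (pullbackSnd g' k).hom ≫ k.hom :=
    congrArg Hom.hom hP.w
  have hl₁ : (hP.lift f g w).hom ≫ (pullbackFst g' k).hom = f.hom :=
    congrArg Hom.hom (hP.lift_fst f g w)
  have hl₂ : (hP.lift f g w).hom ≫ (pullbackSnd g' k).hom = g.hom :=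
    congrArg Hom.hom (hP.lift_snd f g w)
  -- For (a', b) in the pullback, lift b to x along `g`. Then f x and a' agree under `g'`, so
  -- locally there are u, v with g u = g v, f u = f x, f v = a'. Permuting the kernel pairs gives t
  -- with g t = b and f t = a'.
  have lift : ∀ {Z : C} (z : Z ⟶ (pullback g' k).carrier),
      ∃ (Z' : C) (p : Z' ⟶ Z) (x : Z' ⟶ A.carrier), IsRegularEpi p ∧
        x ≫ (hP.lift f g w).hom = p ≫ z := by
    intro Z z
    have := hg.isSurj.isRegularEpi
    obtain ⟨Z₁, p₁, x, hp₁, hx⟩ := exists_local_lift g.hom (z ≫ (pullbackSnd g' k).hom)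
    obtain ⟨Z₂, p₂, u, v, hp₂, huv, hu, hv⟩ := hg.exists_lift_of_eq hf hg'
      (a := x ≫ f.hom) (b := p₁ ≫ z ≫ (pullbackFst g' k).hom) (by
        rw [Category.assoc, w', reassoc_of% hx, Category.assoc, Category.assoc,
          hw])
    obtain ⟨Z₃, p₃, t, hp₃, ht₁, ht₂⟩ := exists_local_permute g.hom f.hom (x := p₂ ≫ x)
      (by rw [Category.assoc, hu]) huv
    refine ⟨Z₃, p₃ ≫ p₂ ≫ p₁, t,
      isRegularEpi_comp _ _ hp₃ (isRegularEpi_comp _ _ hp₂ hp₁), pullback_hom_ext ?_ ?_⟩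
    · rw [Category.assoc, hl₁, ht₂, hv]
      simp only [Category.assoc]
    · rw [Category.assoc, hl₂, ht₁]
      simp only [Category.assoc, hx]
  -- Lift a and b to x and y along the comparison, and their related images in `B` to a related pair
  -- x', y'. The kernel pair of `g` lies in `R`, so x R x' R y' R y.
  have lift_rel : ∀ {R : EqRel A.carrier} {S : EqRel B.carrier}
      {T : EqRel ((pullback g' k).carrier)}, EqRel.LiftsLocally g.hom R S →
      EqRel.Respects ((pullbackSnd g' k).hom) T S →
      (∀ ⦃Z : C⦄ (a b : Z ⟶ A.carrier), a ≫ g.hom = b ≫ g.hom → R.Rel a b) →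
      EqRel.LiftsLocally (hP.lift f g w).hom R T := by
    intro R S T hRS hTS hR Z a b hab
    obtain ⟨Z₁, p₁, x, hp₁, hx⟩ := lift a
    obtain ⟨Z₂, p₂, y, hp₂, hy⟩ := lift (p₁ ≫ b)
    have hxs := congrArg (p₂ ≫ · ≫ (pullbackSnd g' k).hom) hx
    have hys := congrArg (· ≫ (pullbackSnd g' k).hom) hy
    simp only [Category.assoc, hl₂] at hxs hys
    obtain ⟨Z₃, p₃, x', y', hp₃, hxy, hx', hy'⟩ := hRS _ _
      (EqRel.respects_iff.1 hTS _ _ (hab.precomp (p₂ ≫ p₁)))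
    simp only [Category.assoc, ← hxs, ← hys] at hx' hy'
    have h₁ : R.Rel (p₃ ≫ p₂ ≫ x) x' := hR _ _ (by simpa using hx'.symm)
    have h₂ : R.Rel y' (p₃ ≫ y) := hR _ _ (by simpa using hy')
    exact ⟨Z₂, p₂ ≫ p₁, p₂ ≫ x, y, isRegularEpi_comp _ _ hp₂ hp₁,
      EqRel.Rel.of_cover p₃ ((h₁.trans hxy).trans h₂), by simp [hx], by simp [hy]⟩
  have hl : IsSurj (hP.lift f g w) := by
    refine ⟨?_, lift_rel hg.isSurj.liftsLocally_R (pullbackSnd g' k).respects_R hg.rel_R,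
      lift_rel hg.isSurj.liftsLocally_S (pullbackSnd g' k).respects_S hg.rel_S⟩
    obtain ⟨Z, p, x, hp, hx⟩ := lift (𝟙 _)
    exact isRegularEpi_of_local_lift _ ⟨Z, p, x, hp, by rw [hx, Category.comp_id]⟩
  exact {
    w := w
    isRegularEpi_f := hf.isRegularEpi_twoEq
    isRegularEpi_g := hg.isSurj.isRegularEpi_twoEq
    isRegularEpi_h := hg'.isSurj.isRegularEpi_twoEq
    isRegularEpi_k := hk.isRegularEpi_twoEq
    comparison := ⟨_, _, _, hP,
      (IsSurj.of_comp (f := hP.lift f g w) (by rwa [hP.lift_fst])).isRegularEpi_twoEq,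
      (IsSurj.of_comp (f := hP.lift f g w)
        (by rw [hP.lift_snd]; exact hg.isSurj)).isRegularEpi_twoEq,
      hl.isRegularEpi_twoEq⟩ }

end Square

/-! ### The reflection and the final statement -/

theorem nonempty_reflective_conn : Nonempty (Reflective (Conn C).ι) := by
  have hq : ∀ A : TwoEq C, IsCentralization (A.toQuotient (A.R.commutator A.S)) := fun A =>
    A.isCentralization_toQuotient _ A.isCommutator_commutator
  let L : TwoEq C → (Conn C).FullSubcategory := fun A => ⟨A.quotient _, (hq A).centralize⟩
  have hbij : ∀ (A : TwoEq C) (B : (Conn C).FullSubcategory), Function.Bijective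
      (fun k : L A ⟶ B => (A.toQuotient (A.R.commutator A.S) ≫ k.hom : A ⟶ (Conn C).ι.obj B)) := by
    intro A B
    constructor
    · intro k l h
      exact ObjectProperty.hom_ext _ ((hq A).isSurj.cancel h)
    · intro h
      obtain ⟨k, hk⟩ := (hq A).isSurj.exists_desc h ((hq A).eq_of_eq h B.property)
      exact ⟨ObjectProperty.homMk k, hk⟩
  exact ⟨{
    L := Adjunction.leftAdjointOfEquiv (fun A B => Equiv.ofBijective _ (hbij A B))
      (fun A B B' g h => (Category.assoc (A.toQuotient _) h.hom g.hom).symm)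
    adj := Adjunction.adjunctionOfEquivLeft _ _ }⟩

/-- The strong Birkhoff condition ranges over all choices of reflector, so the unit is recognized by
its universal property alone. -/
theorem isCentralization_unit [Reflective (Conn C).ι] (A : TwoEq C) :
    IsCentralization ((reflectorAdjunction (Conn C).ι).unit.app A) := by
  let adj := reflectorAdjunction (Conn C).ι
  refine isCentralization_of_universal (adj.unit.app A) ((reflector (Conn C).ι).obj A).property
    ?_ ?_
  · intro B h hB
    refine ⟨((adj.homEquiv A ⟨B, hB⟩).symm h).hom, ?_⟩
    exact ((adj.homEquiv_unit A ⟨B, hB⟩ _).symm).trans ((adj.homEquiv A ⟨B, hB⟩).apply_symm_apply h)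
  · intro k k' h
    have := (adj.homEquiv A ((reflector (Conn C).ι).obj A)).injective
      (a₁ := (ObjectProperty.homMk k : (reflector (Conn C).ι).obj A ⟶ _))
      (a₂ := ObjectProperty.homMk k')
      (by rw [adj.homEquiv_unit, adj.homEquiv_unit]; exact h)
    exact congrArg (Conn C).ι.map this

end Exact

end TwoEq

end CommutatorTheory

theorem proposition1p1 {C : Type u} [Category.{v} C] [BarrExact C] [Maltsev C]
    [HasCoequalizers C] :
    (∀ A : TwoEq C, ∃ T : EqRel A.carrier, IsCommutator A.R A.S T) ∧
    (∀ (A A' : TwoEq C) (f : A ⟶ A'), IsRegularEpi f →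
      ∀ (T : EqRel A.carrier) (T' : EqRel A'.carrier),
        IsCommutator A.R A.S T → IsCommutator A'.R A'.S T' →
          ∃ fbar : A.quotient T ⟶ A'.quotient T',
            IsRegularPushout f (A.toQuotient T) (A'.toQuotient T') fbar) ∧
    IsStronglyBirkhoff (Conn C) := by
  refine ⟨fun A => ⟨_, A.isCommutator_commutator⟩, ?_, TwoEq.nonempty_reflective_conn, ?_⟩
  · intro A A' f _ T T' hT hT'
    have hq := A.isCentralization_toQuotient T hT
    have hq' := A'.isCentralization_toQuotient T' hT'
    obtain ⟨k, hk⟩ := hq.isSurj.exists_desc (f ≫ A'.toQuotient T')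
      (hq.eq_of_eq _ hq'.centralize)
    exact ⟨k, hq.isRegularPushout (TwoEq.isSurj_of_isRegularEpi f) hq' hk.symm⟩
  · intro _ A B f _
    exact (TwoEq.isCentralization_unit A).isRegularPushout (TwoEq.isSurj_of_isRegularEpi f)
      (TwoEq.isCentralization_unit B) ((reflectorAdjunction (Conn C).ι).unit.naturality f)
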